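/- For complex $c,g$ and an integer $n\ge 0$ write $(c)_n=c(c+1)\cdots(c+n-1)$ and, more generally, $(c)_g=\Gamma(c+g)/\Gamma(c)$. Let $${}_1F_2(a;b,c;z)=\sum_{n=0}^\infty\frac{(a)_n}{(b)_n(c)_n}\frac{z^n}{n!},\qquad J_\nu(z)=\Big(\frac z2\Big)^{\nu}\sum_{m=0}^\infty\frac{(-1)^m}{m!\,\Gamma(m+\nu+1)}\Big(\frac z2\Big)^{2m},$$ complex powers being principal values. Let $k\in\mathbb C$ with $k\neq 0$, and let $\mu\in\mathbb C$ with $\mu\notin\{-1,-2,-3,\dots\}$ and $\mu\notin\{\tfrac12,-\tfrac12,-\tfrac32,\dots\}$. Then $${}_1F_2\Big(\tfrac{\mu}{2}+\tfrac14;\mu+\tfrac12,\mu+1;-k^2\Big)=\sum_{L=0}^{\infty}\frac{(-1)^{2L}\,2^{6L-\frac{\mu}{2}+\frac54}\,\Gamma\big(\tfrac{\mu}{2}+\tfrac34\big)\Gamma(\mu+1)\,k^{2L-\frac{\mu}{2}+\frac14}\,\Big(\big(\tfrac{\mu}{2}+\tfrac14\big)_{2L}\Big)^2\,\Gamma\big(2L+\tfrac{\mu}{2}+\tfrac34\big)\Gamma\big(2L+\mu-\tfrac12\big)}{(2L)!\,\big(2L+\tfrac{\mu}{2}-\tfrac14\big)\,\Gamma\big(\tfrac{\mu}{2}-\tfrac14\big)^2\,\Gamma\big(\tfrac{\mu}{2}+\tfrac14\big)\,\big(L+\tfrac12\big)_{\mu+\frac12}\,\Big(\big(\mu-\tfrac12\big)_{2L}\Big)^2\Big(\big(2L+\mu-\tfrac12\big)_{2L}\Big)^2}$$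 $$\qquad\qquad\times\ J_{2L+\frac{\mu}{2}-\frac14}(k)\;{}_1F_2\Big(L+\tfrac12;\,2L+\tfrac{\mu}{2}+\tfrac34,\,L+\mu+1;\,-\tfrac{k^2}{4}\Big),$$ where the series over $L$ converges absolutely. -/

import Mathlib

noncomputable section

/-- The rising factorial `(c)_n = c (c + 1) ⋯ (c + n - 1)` of a complex number. -/
def risingFac (c : ℂ) (n : ℕ) : ℂ := (ascPochhammer ℂ n).eval c

/-- The Pochhammer symbol `(c)_g = Γ(c + g) / Γ(c)` with an arbitrary complex index `g`. -/
def pochhammerGamma (c g : ℂ) : ℂ := Complex.Gamma (c + g) / Complex.Gamma c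

/-- The generalized hypergeometric series `pFq(a₁, …, a_p; b₁, …, b_q; z)`,
`∑ n, (a₁)_n ⋯ (a_p)_n / ((b₁)_n ⋯ (b_q)_n) * z ^ n / n!`. -/
def hypergeomPFQ (a b : List ℂ) (z : ℂ) : ℂ :=
  ∑' n : ℕ, (a.map fun c => risingFac c n).prod / (b.map fun c => risingFac c n).prod *
    (z ^ n / (n.factorial : ℂ))

/-- The function `1F2(a; b, c; z)`. -/
def hypergeom1F2 (a b c z : ℂ) : ℂ := hypergeomPFQ [a] [b, c] z

/-- The Bessel function of the first kind (principal branch),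
`J_ν(z) = (z / 2) ^ ν * ∑ m, (-1) ^ m / (m! Γ(m + ν + 1)) * (z / 2) ^ (2 m)`.
Mathlib's `Γ` vanishes at its poles, so `1 / Γ` is the entire reciprocal Gamma function. -/
def besselJ (ν z : ℂ) : ℂ :=
  (z / 2) ^ ν *
    ∑' m : ℕ, (-1 : ℂ) ^ m / ((m.factorial : ℂ) * Complex.Gamma (m + ν + 1)) * (z / 2) ^ (2 * m)

end

/-! Put `a = μ/2 - 1/4`, `c = μ + 1 = 2a + 3/2` and `y = -k²/4`. Once the Gamma factors and complex
powers cancel (`coefficient_eq`), the `L`-th term is an explicit coefficient times `y^(2L)`, the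
`0F1` series of the Bessel function and a `1F2` series in `y`. Expanding both gives a triple series
in `(L, m, n)`, absolutely convergent by `summable_tripleTerm`, so it may be summed in any order.

Fix `p = L + m` and `j = L + n`. The sum over `L` is then a terminating very-well-poised `5F4` at
argument one, with parameters `a, a + 1/2, -p, -j`, and has a closed form (`sum_wellPoisedTerm`).
What is left splits into a function of `p + j` times a function of `p` times a function of `j`, so
Chu–Vandermonde (`sum_antidiagonal_inv_risingFac`) evaluates the sum over `p + j = N`. For `c = 2a +
3/2` the duplication formula turns the result into the `N`-th term of the `1F2` series at `4y =
-k²`. -/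

/-! ### Rising factorials and their relation to Gamma. -/

theorem risingFac_zero (c : ℂ) : risingFac c 0 = 1 := by simp [risingFac]

theorem risingFac_succ (c : ℂ) (n : ℕ) : risingFac c (n + 1) = risingFac c n * (c + n) :=
  ascPochhammer_succ_eval n c

theorem risingFac_add (c : ℂ) (m n : ℕ) :
    risingFac c (m + n) = risingFac c m * risingFac (c + m) n := by
  induction n with
  | zero => simp [risingFac_zero]
  | succ n ih =>
    rw [← add_assoc, risingFac_succ, ih, risingFac_succ]
    push_cast
    ring

theorem risingFac_succ_left (c : ℂ) (n : ℕ) :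
    risingFac c (n + 1) = c * risingFac (c + 1) n := by
  rw [add_comm n 1, risingFac_add]
  simp [risingFac_succ, risingFac_zero]

theorem risingFac_ne_zero {c : ℂ} (hc : ∀ i : ℕ, c + i ≠ 0) (n : ℕ) : risingFac c n ≠ 0 := by
  induction n with
  | zero => simp [risingFac_zero]
  | succ n ih => rw [risingFac_succ]; exact mul_ne_zero ih (hc n)

theorem risingFac_one (n : ℕ) : risingFac 1 n = (n.factorial : ℂ) :=
  ascPochhammer_eval_one ℂ n

/-- The duplication formula for the rising factorial. -/
theorem risingFac_two_mul (c : ℂ) (n : ℕ) :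
    risingFac (2 * c) (2 * n) = 4 ^ n * risingFac c n * risingFac (c + 1 / 2) n := by
  induction n with
  | zero => simp [risingFac_zero]
  | succ n ih =>
    rw [show 2 * (n + 1) = 2 * n + 1 + 1 by ring]
    simp only [risingFac_succ, ih, pow_succ]
    push_cast
    ring

theorem factorial_two_mul (n : ℕ) :
    ((2 * n).factorial : ℂ) = 4 ^ n * risingFac (1 / 2) n * (n.factorial : ℂ) := by
  have h := risingFac_two_mul (1 / 2) n
  norm_num [risingFac_one] at h
  simpa using h

theorem risingFac_neg_natCast (m n : ℕ) :
    risingFac (-((m + n : ℕ) : ℂ)) m * (n.factorial : ℂ) = (-1) ^ m * ((m + n).factorial : ℂ) := by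
  induction m with
  | zero => simp [risingFac_zero]
  | succ m ih =>
    rw [risingFac_succ_left, show m + 1 + n = (m + n) + 1 by ring, Nat.factorial_succ]
    rw [show -((m + n + 1 : ℕ) : ℂ) + 1 = -((m + n : ℕ) : ℂ) by push_cast; ring, mul_assoc, ih]
    push_cast
    ring

theorem risingFac_neg_natCast_of_lt {m n : ℕ} (h : n < m) : risingFac (-(n : ℂ)) m = 0 :=
  ascPochhammer_eval_neg_coe_nat_of_lt h

theorem Gamma_add_natCast {c : ℂ} (hc : ∀ i : ℕ, c + i ≠ 0) (n : ℕ) :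
    Complex.Gamma (c + n) = risingFac c n * Complex.Gamma c := by
  induction n with
  | zero => simp [risingFac_zero]
  | succ n ih =>
    rw [risingFac_succ, Nat.cast_succ, ← add_assoc, Complex.Gamma_add_one _ (hc n), ih]
    ring

theorem Gamma_ne_zero_of_add_natCast {c : ℂ} (hc : ∀ i : ℕ, c + i ≠ 0) : Complex.Gamma c ≠ 0 :=
  Complex.Gamma_ne_zero fun m h => hc m (by rw [h]; ring)

/-! ### The terminating very-well-poised `5F4` sum. -/

/-- The general term of a very-well-poised `5F4` series at argument one. -/
noncomputable def wellPoisedTerm (a b c d : ℂ) (L : ℕ) : ℂ :=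
  risingFac a L * risingFac b L * risingFac c L * risingFac d L * (a + 2 * L) /
    (a * (L.factorial : ℂ) * risingFac (1 + a - b) L * risingFac (1 + a - c) L *
      risingFac (1 + a - d) L)

/-- A creative-telescoping certificate: the first-order recurrence in `j` obeyed by the closed form
of the `5F4` holds for the summands up to a difference in `L`. The right side is the telescoped
partial sum, so induction on `M` leaves only a rational identity. -/
theorem sum_wellPoisedTerm_succ_sub {a b c : ℂ} (ha : a ≠ 0) (ha' : ∀ i : ℕ, 1 + a + i ≠ 0)
    (hb : ∀ i : ℕ, 1 + a - b + i ≠ 0) (hc : ∀ i : ℕ, 1 + a - c + i ≠ 0) (j M : ℕ) :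
    ∑ L ∈ Finset.range (M + 1),
      ((1 + a - b + j) * (1 + a - c + j) * wellPoisedTerm a b c (-((j + 1 : ℕ) : ℂ)) L -
        (1 + a + j) * (1 + a - b - c + j) * wellPoisedTerm a b c (-(j : ℂ)) L) =
      risingFac a M * risingFac b M * risingFac c M * risingFac (-(j : ℂ)) M *
        ((a + M) * (b + M) * (c + M)) /
        (a * (M.factorial : ℂ) * risingFac (1 + a - b) M * risingFac (1 + a - c) M *
          risingFac (2 + a + j) M) := by
  have h2 : ∀ i : ℕ, 2 + a + j + i ≠ 0 := fun i => by
    have := ha' (j + 1 + i); push_cast at this; intro h; apply this; rw [← h]; ring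
  have hj1 : (1 + a + j) ≠ 0 := ha' j
  induction M with
  | zero =>
    simp only [zero_add, Finset.sum_range_one, wellPoisedTerm, risingFac_zero]
    field_simp
    push_cast
    ring
  | succ M ih =>
    rw [Finset.sum_range_succ, ih]
    have e1 : risingFac (1 + a - -(j : ℂ)) (M + 1) = (1 + a + j) * risingFac (2 + a + j) M := by
      rw [risingFac_succ_left]; ring_nf
    have e2 : risingFac (1 + a - -((j + 1 : ℕ) : ℂ)) (M + 1)
        = risingFac (2 + a + j) M * (2 + a + j + M) := by
      rw [risingFac_succ]; push_cast; ring_nf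
    have e3 : risingFac (-((j + 1 : ℕ) : ℂ)) (M + 1)
        = -(j + 1) * risingFac (-(j : ℂ)) M := by
      rw [risingFac_succ_left]; push_cast; ring_nf
    have n1 := risingFac_ne_zero hb M
    have n2 := risingFac_ne_zero hc M
    have n3 := risingFac_ne_zero h2 M
    have n4 := hb M
    have n5 := hc M
    have n6 := h2 M
    have n7 : (M.factorial : ℂ) ≠ 0 := by exact_mod_cast M.factorial_ne_zero
    have n8 : (M + 1 : ℂ) ≠ 0 := by exact_mod_cast M.succ_ne_zero
    simp only [wellPoisedTerm, e1, e2, e3]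
    simp only [risingFac_succ, Nat.factorial_succ]
    push_cast
    field_simp
    ring

/-- The summation formula for a terminating very-well-poised `5F4` series. -/
theorem sum_wellPoisedTerm {a b c : ℂ} (ha : a ≠ 0) (ha' : ∀ i : ℕ, 1 + a + i ≠ 0)
    (hb : ∀ i : ℕ, 1 + a - b + i ≠ 0) (hc : ∀ i : ℕ, 1 + a - c + i ≠ 0) (j : ℕ) :
    ∑ L ∈ Finset.range (j + 1), wellPoisedTerm a b c (-(j : ℂ)) L =
      risingFac (1 + a) j * risingFac (1 + a - b - c) j /
        (risingFac (1 + a - b) j * risingFac (1 + a - c) j) := by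
  induction j with
  | zero => simp [wellPoisedTerm, risingFac_zero, ha]
  | succ j ih =>
    have h := sum_wellPoisedTerm_succ_sub ha ha' hb hc j (j + 1)
    -- At `M = j + 1` the boundary term contains `(-j)_(j+1) = 0`, so the recurrence becomes exact.
    rw [risingFac_neg_natCast_of_lt (Nat.lt_succ_self j), Finset.sum_sub_distrib,
      ← Finset.mul_sum, ← Finset.mul_sum,
      Finset.sum_range_succ (fun L => wellPoisedTerm a b c (-(j : ℂ)) L), ih] at h
    have hz : wellPoisedTerm a b c (-(j : ℂ)) (j + 1) = 0 := by
      simp [wellPoisedTerm, risingFac_neg_natCast_of_lt (Nat.lt_succ_self j)]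
    rw [hz] at h
    simp only [mul_zero, zero_mul, zero_div, add_zero, sub_eq_zero] at h
    have n1 := risingFac_ne_zero hb j
    have n2 := risingFac_ne_zero hc j
    have n4 := hb j
    have n5 := hc j
    simp only [risingFac_succ]
    field_simp
    field_simp at h
    linear_combination h

/-! ### Chu–Vandermonde. -/

/-- The Chu–Vandermonde identity, in the form of a Cauchy product. -/
theorem sum_antidiagonal_inv_risingFac {b c : ℂ} (hb : ∀ i : ℕ, b + i ≠ 0)
    (hc : ∀ i : ℕ, c + i ≠ 0) (N : ℕ) :
    ∑ q ∈ Finset.HasAntidiagonal.antidiagonal N,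
      1 / (risingFac b q.1 * (q.1.factorial : ℂ) * (risingFac c q.2 * (q.2.factorial : ℂ))) =
      risingFac (b + c + N - 1) N / ((N.factorial : ℂ) * risingFac b N * risingFac c N) := by
  have desc : ∀ (s : ℂ) (n : ℕ), (descPochhammer ℤ n).smeval s = risingFac (s - n + 1) n := by
    intro s n
    rw [Polynomial.descPochhammer_smeval_eq_ascPochhammer, Polynomial.ascPochhammer_smeval_eq_eval,
      risingFac]
  -- The shifts by `N - 1` make each falling factorial a quotient of rising ones: for `m + n = N`,
  -- the one of `c + N - 1` of length `m` is `(c + n)_m = (c)_N / (c)_n`, and likewise for `b`.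
  have h := Ring.descPochhammer_smeval_add (r := c + N - 1) (s := b + N - 1) N (Commute.all _ _)
  simp only [desc] at h
  rw [show c + N - 1 + (b + N - 1) - N + 1 = b + c + N - 1 by ring] at h
  rw [h, Finset.sum_div]
  refine Finset.sum_congr rfl fun q hq => ?_
  obtain ⟨m, n⟩ := q
  obtain rfl : m + n = N := by simpa using hq
  have e1 : c + ((m + n : ℕ) : ℂ) - 1 - m + 1 = c + n := by push_cast; ring
  have e2 : b + ((m + n : ℕ) : ℂ) - 1 - n + 1 = b + m := by push_cast; ring
  have e3 : ((m + n).factorial : ℂ) = (m + n).choose m * m.factorial * n.factorial := by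
    rw [← Nat.add_choose_mul_factorial_mul_factorial m n, Nat.choose_symm_add]; push_cast; ring
  have e4 := risingFac_add b m n
  have e5 : risingFac c (m + n) = risingFac c n * risingFac (c + n) m := by
    rw [add_comm m n, risingFac_add]
  have n1 := risingFac_ne_zero hb (m + n)
  have n2 := risingFac_ne_zero hc (m + n)
  rw [e4] at n1
  rw [e5] at n2
  have n3 : (((m + n).choose m : ℕ) : ℂ) ≠ 0 := by
    exact_mod_cast (Nat.choose_pos (Nat.le_add_right m n)).ne'
  have n4 : (m.factorial : ℂ) ≠ 0 := by exact_mod_cast m.factorial_ne_zero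
  have n5 : (n.factorial : ℂ) ≠ 0 := by exact_mod_cast n.factorial_ne_zero
  obtain ⟨n11, n12⟩ := mul_ne_zero_iff.1 n1
  obtain ⟨n21, n22⟩ := mul_ne_zero_iff.1 n2
  simp only [e1, e2, e3, e4, e5]
  field_simp

/-! ### Rearrangement of the triple series. -/

/-- The general term of the triple series obtained by expanding both power series in
`∑ L, K_L * 0F1(; 2 L + a + 1; y) * 1F2(L + 1/2; 2 L + a + 1, L + c; y)`. -/
noncomputable def tripleTerm (a c y : ℂ) (L m n : ℕ) : ℂ :=
  risingFac (2 * a) (2 * L) * (a + 2 * L) * risingFac (1 / 2) L /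
      (a * ((2 * L).factorial : ℂ) * risingFac c L * risingFac (1 + a) (2 * L) ^ 2) * y ^ (2 * L) *
    (y ^ m / ((m.factorial : ℂ) * risingFac (1 + a + 2 * L) m) *
      (risingFac (1 / 2 + L) n / (risingFac (1 + a + 2 * L) n * risingFac (c + L) n) *
        (y ^ n / (n.factorial : ℂ))))

theorem half_add_natCast_ne_zero (i : ℕ) : (1 / 2 : ℂ) + i ≠ 0 := by
  have : ((1 / 2 + i : ℝ) : ℂ) ≠ 0 := by
    exact_mod_cast (by positivity : (1 / 2 + i : ℝ) ≠ 0)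
  simpa using this

/-- Duplication turns `(2a)_(2L) / (2L)!` into `(a)_L (a + 1/2)_L / ((1/2)_L L!)`, and `1/2 = 1 + a
- (a + 1/2)` is the partner of `a + 1/2` in the well-poised pairing. The factorials `m!` and `n!`
come from `(-p)_L` and `(-j)_L`, whose signs `(-1)^L` cancel. -/
theorem tripleTerm_eq_wellPoisedTerm {a c : ℂ} (ha : a ≠ 0) (ha' : ∀ i : ℕ, 1 + a + i ≠ 0)
    (hc : ∀ i : ℕ, c + i ≠ 0) (y : ℂ) (L m n : ℕ) :
    tripleTerm a c y L m n =
      y ^ (L + m + (L + n)) * risingFac (1 / 2) (L + n) /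
        (risingFac c (L + n) * risingFac (1 + a) (L + m) * risingFac (1 + a) (L + n) *
          ((L + m).factorial : ℂ) * ((L + n).factorial : ℂ)) *
        wellPoisedTerm a (a + 1 / 2) (-((L + m : ℕ) : ℂ)) (-((L + n : ℕ) : ℂ)) L := by
  have h2 : ∀ i : ℕ, 1 + a + 2 * L + i ≠ 0 := fun i => by
    have := ha' (2 * L + i); push_cast at this; rwa [← add_assoc] at this
  have split : ∀ m : ℕ, risingFac (1 + a) (L + m) * risingFac (1 + a - -((L + m : ℕ) : ℂ)) L =
      risingFac (1 + a) (2 * L) * risingFac (1 + a + 2 * L) m := fun m => by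
    rw [sub_neg_eq_add, ← risingFac_add, show L + m + L = 2 * L + m by ring, risingFac_add]
    push_cast
    ring
  have n0 : ∀ m : ℕ, risingFac (1 + a + 2 * L) m ≠ 0 := risingFac_ne_zero h2
  have n1 : ∀ m : ℕ, risingFac (1 + a) m ≠ 0 := risingFac_ne_zero ha'
  have n2 : ∀ m : ℕ, risingFac c m ≠ 0 := risingFac_ne_zero hc
  have n3 : ∀ m : ℕ, risingFac (1 / 2) m ≠ 0 := risingFac_ne_zero half_add_natCast_ne_zero
  have n4 : ∀ m : ℕ, (m.factorial : ℂ) ≠ 0 := fun m => by exact_mod_cast m.factorial_ne_zero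
  have ew : ∀ m : ℕ, risingFac (1 + a - -((L + m : ℕ) : ℂ)) L =
      risingFac (1 + a) (2 * L) * risingFac (1 + a + 2 * L) m / risingFac (1 + a) (L + m) :=
    fun m => by rw [← split, mul_div_cancel_left₀ _ (n1 _)]
  have en : ∀ m : ℕ, risingFac (-((L + m : ℕ) : ℂ)) L =
      (-1) ^ L * ((L + m).factorial : ℂ) / (m.factorial : ℂ) :=
    fun m => by rw [← risingFac_neg_natCast, mul_div_cancel_right₀ _ (n4 _)]
  have n5 : risingFac (c + L) n ≠ 0 := by
    have := n2 (L + n); rw [risingFac_add] at this; exact (mul_ne_zero_iff.1 this).2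
  have e5 : (1 + a - (a + 1 / 2) : ℂ) = 1 / 2 := by ring
  have sgn : ((-1 : ℂ) ^ L) ^ 2 = 1 := by rw [← pow_mul, mul_comm, pow_mul]; simp
  unfold tripleTerm wellPoisedTerm
  rw [ew, ew, en, en, e5, risingFac_add c L n, risingFac_add (1 / 2) L n, factorial_two_mul,
    risingFac_two_mul]
  have := n0 m
  have := n0 n
  have := n1 (2 * L)
  have := n1 (L + m)
  have := n1 (L + n)
  have := n2 L
  have := n3 L
  have := n4 L
  have := n4 m
  have := n4 n
  have := n4 (L + m)
  have := n4 (L + n)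
  generalize risingFac (1 + a + 2 * L) m = A1 at *
  generalize risingFac (1 + a + 2 * L) n = A2 at *
  generalize risingFac (1 / 2 + L) n = A3 at *
  generalize risingFac (1 / 2) L = A4 at *
  field_simp
  rw [sgn]
  ring

/-- The sum of the triple series over `L`, with `p = L + m` and `j = L + n` held fixed. -/
theorem sum_tripleTerm {a c : ℂ} (ha : a ≠ 0) (ha' : ∀ i : ℕ, 1 + a + i ≠ 0)
    (hc : ∀ i : ℕ, c + i ≠ 0) (y : ℂ) (p j : ℕ) :
    HasSum (fun L => if L ≤ p ∧ L ≤ j then tripleTerm a c y L (p - L) (j - L) else 0)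
      (y ^ (p + j) * risingFac (1 / 2) (p + j) / risingFac (1 + a) (p + j) *
        (1 / (risingFac (1 / 2) p * (p.factorial : ℂ) *
          (risingFac c j * (j.factorial : ℂ))))) := by
  have e5 : (1 + a - (a + 1 / 2) : ℂ) = 1 / 2 := by ring
  have hp : ∀ i : ℕ, 1 + a - -(p : ℂ) + i ≠ 0 := fun i => by
    have := ha' (p + i); push_cast at this; rwa [← add_assoc, ← sub_neg_eq_add (1 + a)] at this
  have hs := sum_wellPoisedTerm (b := a + 1 / 2) (c := -(p : ℂ)) ha ha'
    (by rw [e5]; exact half_add_natCast_ne_zero) hp j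
  have hval : y ^ (p + j) * risingFac (1 / 2) (p + j) / risingFac (1 + a) (p + j) *
        (1 / (risingFac (1 / 2) p * (p.factorial : ℂ) * (risingFac c j * (j.factorial : ℂ)))) =
      ∑ L ∈ Finset.range (j + 1),
        if L ≤ p ∧ L ≤ j then tripleTerm a c y L (p - L) (j - L) else 0 := by
    have hterm : ∀ L ∈ Finset.range (j + 1),
        (if L ≤ p ∧ L ≤ j then tripleTerm a c y L (p - L) (j - L) else 0) =
        y ^ (p + j) * risingFac (1 / 2) j / (risingFac c j * risingFac (1 + a) p *
          risingFac (1 + a) j * (p.factorial : ℂ) * (j.factorial : ℂ)) *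
          wellPoisedTerm a (a + 1 / 2) (-(p : ℂ)) (-(j : ℂ)) L := by
      intro L hL
      have hLj : L ≤ j := Nat.lt_succ_iff.1 (Finset.mem_range.1 hL)
      by_cases hLp : L ≤ p
      · rw [if_pos ⟨hLp, hLj⟩, tripleTerm_eq_wellPoisedTerm ha ha' hc, Nat.add_sub_cancel' hLp,
          Nat.add_sub_cancel' hLj]
      -- For `L > p` the factor `(-p)_L` vanishes, so the `5F4` sum up to `j` respects the cutoff at
      -- `p` by itself.
      · rw [if_neg (fun h => hLp h.1), wellPoisedTerm,
          risingFac_neg_natCast_of_lt (Nat.lt_of_not_le hLp)]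
        simp
    -- The closed form contributes `(1/2 + p)_j` and `(1 + a + p)_j`, which complete `(1/2)_p` and
    -- `(1 + a)_p` to symbols of length `p + j`.
    rw [Finset.sum_congr rfl hterm, ← Finset.mul_sum, hs, e5,
      show (1 / 2 - -(p : ℂ)) = 1 / 2 + p by ring, sub_neg_eq_add, risingFac_add (1 / 2),
      risingFac_add (1 + a)]
    have n1 := risingFac_ne_zero ha'
    have n2 := risingFac_ne_zero hc j
    have n3 := risingFac_ne_zero half_add_natCast_ne_zero
    have n4 : ∀ m : ℕ, (m.factorial : ℂ) ≠ 0 := fun m => by exact_mod_cast m.factorial_ne_zero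
    have := n1 p
    have := n1 j
    have := n1 (p + j)
    rw [risingFac_add] at this
    have := (mul_ne_zero_iff.1 this).2
    have := n3 p
    have := n3 j
    have := n4 p
    have := n4 j
    generalize risingFac (1 / 2) p = A1 at *
    generalize risingFac (1 / 2) j = A2 at *
    field_simp
  rw [hval]
  refine hasSum_sum_of_ne_finset_zero fun L hL => if_neg fun h => hL ?_
  exact Finset.mem_range.2 (Nat.lt_succ_of_le h.2)

/-- The triple series is summed over `L` first, then along the antidiagonals `p + j = N`. -/
theorem hasSum_tripleTerm {a c : ℂ} (ha : a ≠ 0) (ha' : ∀ i : ℕ, 1 + a + i ≠ 0)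
    (hc : ∀ i : ℕ, c + i ≠ 0) (y : ℂ)
    (hsum : Summable fun t : ℕ × ℕ × ℕ => tripleTerm a c y t.1 t.2.1 t.2.2) :
    HasSum (fun N : ℕ => risingFac (1 / 2 + c + N - 1) N / (risingFac (1 + a) N * risingFac c N) *
      (y ^ N / (N.factorial : ℂ)))
      (∑' t : ℕ × ℕ × ℕ, tripleTerm a c y t.1 t.2.1 t.2.2) := by
  let e : ℕ × ℕ × ℕ → (ℕ × ℕ) × ℕ := fun t => ((t.1 + t.2.1, t.1 + t.2.2), t.1)
  have he : Function.Injective e := by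
    rintro ⟨L, m, n⟩ ⟨L', m', n'⟩ h
    simp only [e, Prod.mk.injEq] at h ⊢
    omega
  -- The reindexing `e` only reaches triples with `L ≤ p` and `L ≤ j`; extension by zero accounts
  -- for the others.
  let G : (ℕ × ℕ) × ℕ → ℂ := fun t =>
    if t.2 ≤ t.1.1 ∧ t.2 ≤ t.1.2 then tripleTerm a c y t.2 (t.1.1 - t.2) (t.1.2 - t.2) else 0
  have hG : HasSum G (∑' t : ℕ × ℕ × ℕ, tripleTerm a c y t.1 t.2.1 t.2.2) := by
    rw [← he.hasSum_iff]
    · convert hsum.hasSum using 2 with t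
      simp [G, e]
    · rintro ⟨⟨p, j⟩, L⟩ hx
      refine if_neg fun h => hx ⟨(L, p - L, j - L), ?_⟩
      have h1 : L ≤ p := h.1
      have h2 : L ≤ j := h.2
      simp only [e, Nat.add_sub_cancel' h1, Nat.add_sub_cancel' h2]
  have h1 := hG.prod_fiberwise fun pj => sum_tripleTerm ha ha' hc y pj.1 pj.2
  rw [← Finset.HasAntidiagonal.sigmaAntidiagonalEquivProd.hasSum_iff] at h1
  have h2 := h1.sigma fun N => hasSum_fintype _
  convert h2 using 2 with N
  have n3 := risingFac_ne_zero half_add_natCast_ne_zero N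
  have hq : ∀ q ∈ Finset.HasAntidiagonal.antidiagonal N,
      y ^ (q.1 + q.2) * risingFac (1 / 2) (q.1 + q.2) / risingFac (1 + a) (q.1 + q.2) *
        (1 / (risingFac (1 / 2) q.1 * (q.1.factorial : ℂ) *
          (risingFac c q.2 * (q.2.factorial : ℂ)))) =
      y ^ N * risingFac (1 / 2) N / risingFac (1 + a) N *
        (1 / (risingFac (1 / 2) q.1 * (q.1.factorial : ℂ) *
          (risingFac c q.2 * (q.2.factorial : ℂ)))) := by
    intro q hq
    rw [Finset.HasAntidiagonal.mem_antidiagonal.1 hq]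
  have h3 := Finset.sum_congr rfl hq
  rw [← Finset.mul_sum, sum_antidiagonal_inv_risingFac half_add_natCast_ne_zero hc,
    ← Finset.sum_coe_sort] at h3
  refine Eq.trans ?_ h3.symm
  generalize risingFac (1 / 2) N = A at *
  field_simp

/-! ### Growth bounds and absolute convergence. -/

/-- Finitely many nonzero values are bounded below by a minimum, and beyond them `‖c + i‖ ≥ i - ‖c‖`
grows linearly. All later estimates rest on this constant. -/
theorem exists_mul_le_norm_add_natCast {c : ℂ} (hc : ∀ i : ℕ, c + i ≠ 0) :
    ∃ ε : ℝ, 0 < ε ∧ ∀ i : ℕ, ε * (i + 1) ≤ ‖c + i‖ := by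
  have fin : ∀ N : ℕ, ∃ ε : ℝ, 0 < ε ∧ ∀ i : ℕ, i < N → ε * (i + 1) ≤ ‖c + i‖ := by
    intro N
    induction N with
    | zero => exact ⟨1, one_pos, fun i hi => absurd hi (Nat.not_lt_zero i)⟩
    | succ N ih =>
      obtain ⟨ε, hε, h⟩ := ih
      refine ⟨min ε (‖c + N‖ / (N + 1)),
        lt_min hε (div_pos (norm_pos_iff.2 (hc N)) (by positivity)), fun i hi => ?_⟩
      rcases Nat.lt_succ_iff_lt_or_eq.1 hi with h' | rfl
      · exact le_trans (by gcongr; exact min_le_left _ _) (h i h')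
      · rw [← le_div_iff₀ (by positivity)]
        exact min_le_right _ _
  -- For `i ≥ 2‖c‖ + 1` one has `i - ‖c‖ ≥ (i + 1) / 2`, hence the constant `1 / 2`.
  obtain ⟨N, hN⟩ := exists_nat_ge (2 * ‖c‖ + 1)
  obtain ⟨ε, hε, h⟩ := fin N
  refine ⟨min ε (1 / 2), lt_min hε (by norm_num), fun i => ?_⟩
  rcases lt_or_ge i N with hi | hi
  · exact le_trans (by gcongr; exact min_le_left _ _) (h i hi)
  · have h1 : (N : ℝ) ≤ i := by exact_mod_cast hi
    have h2 : (i : ℝ) ≤ ‖c + i‖ + ‖c‖ := by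
      have := norm_sub_le (c + i) c
      simpa using this
    calc min ε (1 / 2) * ((i : ℝ) + 1) ≤ 1 / 2 * (i + 1) := by gcongr; exact min_le_right _ _
      _ ≤ ‖c + i‖ := by linarith

/-- The point is uniformity in the shift `q`: the same `ε` serves for every `L` in the symbols based
at `1 + a + 2L` and `c + L`. -/
theorem pow_mul_ascFactorial_le_norm_risingFac {c : ℂ} {ε : ℝ} (hε : 0 < ε)
    (h : ∀ i : ℕ, ε * (i + 1) ≤ ‖c + i‖) (q n : ℕ) :
    ε ^ n * ((q + 1).ascFactorial n : ℝ) ≤ ‖risingFac (c + q) n‖ := by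
  induction n with
  | zero => simp [risingFac_zero]
  | succ n ih =>
    rw [risingFac_succ, norm_mul, Nat.ascFactorial_succ]
    have h1 := h (q + n)
    push_cast at h1 ⊢
    rw [← add_assoc] at h1
    calc ε ^ (n + 1) * ((q + 1 + n) * ((q + 1).ascFactorial n : ℝ))
        = (ε ^ n * ((q + 1).ascFactorial n : ℝ)) * (ε * (q + n + 1)) := by ring
      _ ≤ _ := by gcongr

theorem norm_risingFac_le (c : ℂ) (n : ℕ) :
    ‖risingFac c n‖ ≤ (‖c‖ + 1) ^ n * (n.factorial : ℝ) := by
  induction n with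
  | zero => simp [risingFac_zero]
  | succ n ih =>
    rw [risingFac_succ, norm_mul, Nat.factorial_succ]
    have h1 : ‖c + n‖ ≤ (‖c‖ + 1) * (n + 1) := by
      refine (norm_add_le _ _).trans ?_
      rw [Complex.norm_natCast]
      nlinarith [norm_nonneg c, mul_nonneg (norm_nonneg c) n.cast_nonneg]
    push_cast
    calc _ ≤ (‖c‖ + 1) ^ n * (n.factorial : ℝ) * ((‖c‖ + 1) * (n + 1)) := by gcongr
      _ = _ := by ring

theorem norm_risingFac_half_add_le (L n : ℕ) :
    ‖risingFac (1 / 2 + L) n‖ ≤ ((L + 1).ascFactorial n : ℝ) := by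
  induction n with
  | zero => simp [risingFac_zero]
  | succ n ih =>
    rw [risingFac_succ, norm_mul, Nat.ascFactorial_succ]
    have h1 : ‖(1 / 2 : ℂ) + L + n‖ ≤ L + 1 + n := by
      rw [add_assoc]
      refine (norm_add_le _ _).trans ?_
      rw [← Nat.cast_add, Complex.norm_natCast]
      norm_num
      linarith
    push_cast
    rw [mul_comm]
    gcongr

theorem ascFactorial_le_ascFactorial_left {p q : ℕ} (h : p ≤ q) (n : ℕ) :
    p.ascFactorial n ≤ q.ascFactorial n := by
  induction n with
  | zero => simp
  | succ n ih =>
    rw [Nat.ascFactorial_succ, Nat.ascFactorial_succ]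
    gcongr

/-- Numerator and denominator are both compared with `(q + 1)_n`, which cancels; thus the numerator
of the `1F2` costs only a geometric factor, uniformly in `L`. -/
theorem norm_risingFac_half_div_le {c : ℂ} {ε : ℝ} (hε : 0 < ε)
    (h : ∀ i : ℕ, ε * (i + 1) ≤ ‖c + i‖) {p q : ℕ} (hpq : p ≤ q) (n : ℕ) :
    ‖risingFac (1 / 2 + p) n / risingFac (c + q) n‖ ≤ (1 / ε) ^ n := by
  have h1 := pow_mul_ascFactorial_le_norm_risingFac hε h q n
  have h2 : ((p + 1).ascFactorial n : ℝ) ≤ (q + 1).ascFactorial n := by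
    exact_mod_cast ascFactorial_le_ascFactorial_left (by omega) n
  have h3 : (0 : ℝ) < (q + 1).ascFactorial n := by exact_mod_cast Nat.ascFactorial_pos _ _
  rw [norm_div, div_le_iff₀ (lt_of_lt_of_le (by positivity) h1)]
  calc _ ≤ ((q + 1).ascFactorial n : ℝ) := (norm_risingFac_half_add_le p n).trans h2
    _ = (1 / ε) ^ n * (ε ^ n * ((q + 1).ascFactorial n : ℝ)) := by
      rw [← mul_assoc, ← mul_pow, one_div_mul_cancel hε.ne', one_pow, one_mul]
    _ ≤ _ := by gcongr

theorem norm_inv_risingFac_le {c : ℂ} {ε : ℝ} (hε : 0 < ε)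
    (h : ∀ i : ℕ, ε * (i + 1) ≤ ‖c + i‖) (q n : ℕ) :
    ‖(risingFac (c + q) n)⁻¹‖ ≤ (1 / ε) ^ n / (n.factorial : ℝ) := by
  have h1 := pow_mul_ascFactorial_le_norm_risingFac hε h q n
  have h2 : (n.factorial : ℝ) ≤ (q + 1).ascFactorial n := by
    rw [← Nat.one_ascFactorial]
    exact_mod_cast ascFactorial_le_ascFactorial_left (by omega) n
  rw [norm_inv, one_div, inv_pow, inv_eq_one_div (ε ^ n), div_div, ← one_div]
  refine one_div_le_one_div_of_le (by positivity) (le_trans ?_ h1)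
  gcongr

theorem norm_inv_risingFac_le_pow {c : ℂ} {ε : ℝ} (hε : 0 < ε)
    (h : ∀ i : ℕ, ε * (i + 1) ≤ ‖c + i‖) (q n : ℕ) :
    ‖(risingFac (c + q) n)⁻¹‖ ≤ (1 / ε) ^ n :=
  (norm_inv_risingFac_le hε h q n).trans <| div_le_self (by positivity) <| by
    exact_mod_cast Nat.one_le_iff_ne_zero.2 n.factorial_ne_zero

theorem norm_zeroFOne_term_le {c : ℂ} {ε : ℝ} (hε : 0 < ε)
    (h : ∀ i : ℕ, ε * (i + 1) ≤ ‖c + i‖) (q : ℕ) (y : ℂ) (m : ℕ) :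
    ‖y ^ m / ((m.factorial : ℂ) * risingFac (c + q) m)‖ ≤
      (‖y‖ * (1 / ε)) ^ m / (m.factorial : ℝ) := by
  have hb := norm_inv_risingFac_le_pow hε h q m
  rw [← div_div, div_eq_mul_inv _ (risingFac _ _), norm_mul, norm_div, norm_pow,
    Complex.norm_natCast]
  calc _ ≤ ‖y‖ ^ m / (m.factorial : ℝ) * (1 / ε) ^ m := by gcongr
    _ = _ := by rw [mul_pow]; ring

theorem norm_oneFTwo_term_le {b c : ℂ} {δ ε : ℝ} (hδ : 0 < δ)
    (hb : ∀ i : ℕ, δ * (i + 1) ≤ ‖b + i‖) (hε : 0 < ε) (hc : ∀ i : ℕ, ε * (i + 1) ≤ ‖c + i‖)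
    {p q : ℕ} (hpq : p ≤ q) (y : ℂ) (n : ℕ) :
    ‖risingFac (1 / 2 + p) n / (risingFac (b + q) n * risingFac (c + p) n) *
        (y ^ n / (n.factorial : ℂ))‖ ≤ (1 / δ * (1 / ε) * ‖y‖) ^ n / (n.factorial : ℝ) := by
  have hb1 := norm_risingFac_half_div_le hδ hb hpq n
  have hb2 := norm_inv_risingFac_le_pow hε hc p n
  rw [← div_div, div_eq_mul_inv _ (risingFac (c + p) n), norm_mul, norm_mul, norm_div (y ^ n),
    norm_pow, Complex.norm_natCast]
  calc _ ≤ (1 / δ) ^ n * (1 / ε) ^ n * (‖y‖ ^ n / (n.factorial : ℝ)) := by gcongr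
    _ = _ := by rw [mul_pow, mul_pow]; ring

theorem summable_norm_zeroFOne_term {c : ℂ} (hc : ∀ i : ℕ, c + i ≠ 0) (q : ℕ) (y : ℂ) :
    Summable fun m : ℕ => ‖y ^ m / ((m.factorial : ℂ) * risingFac (c + q) m)‖ := by
  obtain ⟨ε, hε, h⟩ := exists_mul_le_norm_add_natCast hc
  exact .of_nonneg_of_le (fun _ => norm_nonneg _) (norm_zeroFOne_term_le hε h q y)
    (Real.summable_pow_div_factorial _)

theorem summable_norm_oneFTwo_term {b c : ℂ} (hb : ∀ i : ℕ, b + i ≠ 0)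
    (hc : ∀ i : ℕ, c + i ≠ 0) {p q : ℕ} (hpq : p ≤ q) (y : ℂ) :
    Summable fun n : ℕ => ‖risingFac (1 / 2 + p) n / (risingFac (b + q) n * risingFac (c + p) n) *
        (y ^ n / (n.factorial : ℂ))‖ := by
  obtain ⟨δ, hδ, h⟩ := exists_mul_le_norm_add_natCast hb
  obtain ⟨ε, hε, h'⟩ := exists_mul_le_norm_add_natCast hc
  exact .of_nonneg_of_le (fun _ => norm_nonneg _) (norm_oneFTwo_term_le hδ h hε h' hpq y)
    (Real.summable_pow_div_factorial _)

/-- The term is dominated by a product `f L * g m * h n` of exponential-series terms, the bounds in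
`m` and `n` being uniform in `L`. -/
theorem summable_tripleTerm {a c : ℂ} (ha' : ∀ i : ℕ, 1 + a + i ≠ 0)
    (hc : ∀ i : ℕ, c + i ≠ 0) (y : ℂ) :
    Summable fun t : ℕ × ℕ × ℕ => tripleTerm a c y t.1 t.2.1 t.2.2 := by
  obtain ⟨δ, hδ, hδa⟩ := exists_mul_le_norm_add_natCast ha'
  obtain ⟨ε, hε, hεc⟩ := exists_mul_le_norm_add_natCast hc
  set f : ℕ → ℝ := fun L => (‖a‖ + 2) / ‖a‖ *
    (((‖2 * a‖ + 1) ^ 2 * 2 * (1 / ε) * ((1 / δ) ^ 2) ^ 2 * ‖y‖ ^ 2) ^ L / (L.factorial : ℝ)) with hf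
  set g : ℕ → ℝ := fun m => (‖y‖ * (1 / δ)) ^ m / (m.factorial : ℝ) with hg
  set h : ℕ → ℝ := fun n => (1 / δ * (1 / ε) * ‖y‖) ^ n / (n.factorial : ℝ) with hh
  have sf : Summable f := (Real.summable_pow_div_factorial _).mul_left _
  have sg : Summable g := Real.summable_pow_div_factorial _
  have sh : Summable h := Real.summable_pow_div_factorial _
  have f0 : 0 ≤ f := fun L => by simp only [hf, Pi.zero_apply]; positivity
  have g0 : 0 ≤ g := fun L => by simp only [hg, Pi.zero_apply]; positivity
  have h0 : 0 ≤ h := fun L => by simp only [hh, Pi.zero_apply]; positivity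
  have sgh := sg.mul_of_nonneg sh g0 h0
  refine Summable.of_norm_bounded
    (sf.mul_of_nonneg sgh f0 fun t => mul_nonneg (g0 t.1) (h0 t.2)) ?_
  rintro ⟨L, m, n⟩
  have fac1 : ∀ n : ℕ, (1 : ℝ) ≤ n.factorial := fun n => by
    exact_mod_cast Nat.one_le_iff_ne_zero.2 n.factorial_ne_zero
  have bf : ‖risingFac (2 * a) (2 * L) * (a + 2 * L) * risingFac (1 / 2) L /
      (a * ((2 * L).factorial : ℂ) * risingFac c L * risingFac (1 + a) (2 * L) ^ 2) *
        y ^ (2 * L)‖ ≤ f L := by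
    have e : risingFac (2 * a) (2 * L) * (a + 2 * L) * risingFac (1 / 2) L /
        (a * ((2 * L).factorial : ℂ) * risingFac c L * risingFac (1 + a) (2 * L) ^ 2) * y ^ (2 * L)
        = (risingFac (2 * a) (2 * L) / ((2 * L).factorial : ℂ)) * ((a + 2 * L) / a) *
          (risingFac (1 / 2 + (0 : ℕ)) L / risingFac (c + (0 : ℕ)) L) *
          (risingFac (1 + a + (0 : ℕ)) (2 * L))⁻¹ ^ 2 * y ^ (2 * L) := by
      rw [Nat.cast_zero, add_zero, add_zero, add_zero]
      simp only [div_eq_mul_inv, mul_inv, inv_pow]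
      ring
    have b1 : ‖risingFac (2 * a) (2 * L) / ((2 * L).factorial : ℂ)‖ ≤ (‖2 * a‖ + 1) ^ (2 * L) := by
      rw [norm_div, Complex.norm_natCast, div_le_iff₀ (by positivity)]
      exact norm_risingFac_le _ _
    have b2 : ‖(a + 2 * L) / a‖ ≤ (‖a‖ + 2) * 2 ^ L / ‖a‖ := by
      rw [norm_div]
      gcongr
      have h1 : (L : ℝ) + 1 ≤ 2 ^ L := by exact_mod_cast Nat.lt_two_pow_self
      calc ‖a + 2 * L‖ ≤ ‖a‖ + 2 * L := by
            refine (norm_add_le _ _).trans ?_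
            rw [norm_mul, Complex.norm_natCast]; norm_num
        _ ≤ (‖a‖ + 2) * (L + 1) := by
            nlinarith [norm_nonneg a, mul_nonneg (norm_nonneg a) L.cast_nonneg]
        _ ≤ _ := by gcongr
    have b3 := norm_risingFac_half_div_le hε hεc (le_refl 0) L
    have b4 : ‖(risingFac (1 + a + (0 : ℕ)) (2 * L))⁻¹ ^ 2‖ ≤
        ((1 / δ) ^ (2 * L)) ^ 2 / (L.factorial : ℝ) := by
      have hb := norm_inv_risingFac_le hδ hδa 0 (2 * L)
      -- Every other factor in `L` grows at most geometrically, so a single `L!` from the squared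
      -- denominator is enough.
      have hL : (L.factorial : ℝ) ≤ ((2 * L).factorial : ℝ) ^ 2 := by
        have h1 : (L.factorial : ℝ) ≤ (2 * L).factorial := by
          exact_mod_cast Nat.factorial_le (by omega)
        nlinarith [fac1 (2 * L)]
      rw [norm_pow]
      calc _ ≤ ((1 / δ) ^ (2 * L) / ((2 * L).factorial : ℝ)) ^ 2 := by gcongr
        _ = ((1 / δ) ^ (2 * L)) ^ 2 / ((2 * L).factorial : ℝ) ^ 2 := div_pow _ _ _
        _ ≤ _ := by gcongr
    rw [e, norm_mul, norm_mul, norm_mul, norm_mul, norm_pow y]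
    calc _ ≤ (‖2 * a‖ + 1) ^ (2 * L) * ((‖a‖ + 2) * 2 ^ L / ‖a‖) * (1 / ε) ^ L *
          (((1 / δ) ^ (2 * L)) ^ 2 / (L.factorial : ℝ)) * ‖y‖ ^ (2 * L) := by gcongr
      _ = f L := by
        simp only [hf, mul_pow, ← pow_mul]
        ring
  have bg := norm_zeroFOne_term_le hδ hδa (2 * L) y m
  have bh := norm_oneFTwo_term_le hδ hδa hε hεc (show L ≤ 2 * L by omega) y n
  push_cast at bg bh
  exact (norm_mul_le _ _).trans (mul_le_mul bf ((norm_mul_le _ _).trans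
    (mul_le_mul bg bh (norm_nonneg _) (g0 m))) (norm_nonneg _) (f0 L))

/-! ### The same triple series summed over `m` and `n` first. -/

theorem hasSum_mul_of_summable_norm {f g : ℕ → ℂ} (hf : Summable fun m => ‖f m‖)
    (hg : Summable fun n => ‖g n‖) :
    HasSum (fun q : ℕ × ℕ => f q.1 * g q.2) ((∑' m, f m) * ∑' n, g n) := by
  rw [tsum_mul_tsum_of_summable_norm hf hg]
  exact (summable_mul_of_summable_norm hf hg).hasSum

theorem hasSum_tripleTerm_fiber {a c : ℂ} (ha' : ∀ i : ℕ, 1 + a + i ≠ 0)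
    (hc : ∀ i : ℕ, c + i ≠ 0) (y : ℂ) (L : ℕ) :
    HasSum (fun q : ℕ × ℕ => tripleTerm a c y L q.1 q.2)
      (risingFac (2 * a) (2 * L) * (a + 2 * L) * risingFac (1 / 2) L /
        (a * ((2 * L).factorial : ℂ) * risingFac c L * risingFac (1 + a) (2 * L) ^ 2) *
        y ^ (2 * L) *
      ((∑' m : ℕ, y ^ m / ((m.factorial : ℂ) * risingFac (1 + a + 2 * L) m)) *
        ∑' n : ℕ, risingFac (1 / 2 + L) n / (risingFac (1 + a + 2 * L) n * risingFac (c + L) n) *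
          (y ^ n / (n.factorial : ℂ)))) := by
  have hL : L ≤ 2 * L := by omega
  have hA := summable_norm_zeroFOne_term ha' (2 * L) y
  have hB := summable_norm_oneFTwo_term ha' hc hL y
  rw [Nat.cast_mul, Nat.cast_ofNat] at hA hB
  have hAB := hasSum_mul_of_summable_norm hA hB
  exact hAB.mul_left _

theorem hasSum_tsum_mul_tsum {a c : ℂ} (ha : a ≠ 0) (ha' : ∀ i : ℕ, 1 + a + i ≠ 0)
    (hc : ∀ i : ℕ, c + i ≠ 0) (y : ℂ) :
    HasSum (fun L : ℕ =>
      risingFac (2 * a) (2 * L) * (a + 2 * L) * risingFac (1 / 2) L /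
        (a * ((2 * L).factorial : ℂ) * risingFac c L * risingFac (1 + a) (2 * L) ^ 2) *
        y ^ (2 * L) *
      ((∑' m : ℕ, y ^ m / ((m.factorial : ℂ) * risingFac (1 + a + 2 * L) m)) *
        ∑' n : ℕ, risingFac (1 / 2 + L) n / (risingFac (1 + a + 2 * L) n * risingFac (c + L) n) *
          (y ^ n / (n.factorial : ℂ))))
      (∑' N : ℕ, risingFac (1 / 2 + c + N - 1) N / (risingFac (1 + a) N * risingFac c N) *
        (y ^ N / (N.factorial : ℂ))) := by
  have hsum := summable_tripleTerm ha' hc y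
  rw [(hasSum_tripleTerm ha ha' hc y hsum).tsum_eq]
  exact HasSum.prod_fiberwise hsum.hasSum fun L => hasSum_tripleTerm_fiber ha' hc y L

/-! ### Bessel functions, principal powers and the coefficient. -/

theorem besselJ_eq {ν : ℂ} (hν : ∀ i : ℕ, 1 + ν + i ≠ 0) (k : ℂ) :
    besselJ ν k = (k / 2) ^ ν / Complex.Gamma (1 + ν) *
      ∑' m : ℕ, (-k ^ 2 / 4) ^ m / ((m.factorial : ℂ) * risingFac (1 + ν) m) := by
  rw [besselJ, div_mul_eq_mul_div, mul_div_assoc, ← tsum_div_const]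
  congr 1
  refine tsum_congr fun m => ?_
  rw [show (m : ℂ) + ν + 1 = 1 + ν + m by ring, Gamma_add_natCast hν, pow_mul,
    show -k ^ 2 / 4 = -1 * (k / 2) ^ 2 by ring, mul_pow (-1 : ℂ)]
  simp only [div_eq_mul_inv, mul_inv]
  ring

theorem hypergeom1F2_eq (a b c z : ℂ) :
    hypergeom1F2 a b c z =
      ∑' n : ℕ, risingFac a n / (risingFac b n * risingFac c n) * (z ^ n / (n.factorial : ℂ)) := by
  simp [hypergeom1F2, hypergeomPFQ]

theorem cpow_mul_cpow_mul_div_two_cpow {k : ℂ} (hk : k ≠ 0) (a : ℂ) (L : ℕ) :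
    (2 : ℂ) ^ (6 * (L : ℂ) - a + 1) * k ^ (2 * (L : ℂ) - a) * (k / 2) ^ (2 * (L : ℂ) + a) =
      2 ^ (4 * L) * k ^ (4 * L) * 2 ^ (1 - 2 * a) := by
  have h2 : (2 : ℂ) ≠ 0 := two_ne_zero
  have hdiv : (k / 2) ^ (2 * (L : ℂ) + a) = k ^ (2 * (L : ℂ) + a) * 2 ^ (-(2 * (L : ℂ) + a)) := by
    -- Dividing by a positive real does not change the argument, so the principal power of `k / 2`
    -- splits without a branch correction.
    have hlog : Complex.log (k / 2) = Complex.log k - Complex.log 2 := by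
      have h := Complex.log_ofReal_mul (r := 2) two_pos (div_ne_zero hk h2)
      rw [Complex.ofReal_ofNat, mul_div_cancel₀ _ h2] at h
      rw [h, ← Complex.ofReal_ofNat, Complex.ofReal_log (by norm_num)]
      simp
    rw [Complex.cpow_def_of_ne_zero (div_ne_zero hk h2), Complex.cpow_def_of_ne_zero hk,
      Complex.cpow_def_of_ne_zero h2, ← Complex.exp_add, hlog]
    ring_nf
  calc _ = ((2 : ℂ) ^ (6 * (L : ℂ) - a + 1) * 2 ^ (-(2 * (L : ℂ) + a))) *
        (k ^ (2 * (L : ℂ) - a) * k ^ (2 * (L : ℂ) + a)) := by rw [hdiv]; ring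
    _ = (2 : ℂ) ^ (((4 * L : ℕ) : ℂ) + (1 - 2 * a)) * k ^ (((4 * L : ℕ) : ℂ)) := by
      rw [← Complex.cpow_add _ _ h2, ← Complex.cpow_add _ _ hk]
      push_cast
      ring_nf
    _ = _ := by
      rw [Complex.cpow_add _ _ h2, Complex.cpow_natCast, Complex.cpow_natCast]
      ring

/-- The factors `√π` and `2^(1 - 2a)` produced by Legendre duplication for `Γ(a) Γ(a + 1/2)` cancel
those from `Γ(1/2)` and from the complex powers. -/
theorem coefficient_eq {a k : ℂ} (hk : k ≠ 0) (ha : ∀ i : ℕ, 2 * a + i ≠ 0)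
    (hc : ∀ i : ℕ, 2 * a + 3 / 2 + i ≠ 0) (L : ℕ) :
    ((-1 : ℂ) ^ (2 * L) * (2 : ℂ) ^ (6 * (L : ℂ) - a + 1) *
            Complex.Gamma (1 + a) * Complex.Gamma (2 * a + 3 / 2) *
            k ^ (2 * (L : ℂ) - a) *
            (risingFac (a + 1 / 2) (2 * L)) ^ 2 *
            Complex.Gamma (1 + a + 2 * L) *
            Complex.Gamma (2 * a + 2 * L)) /
          (((2 * L).factorial : ℂ) * (a + 2 * L) *
            (Complex.Gamma a) ^ 2 * Complex.Gamma (a + 1 / 2) *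
            pochhammerGamma (1 / 2 + L) (2 * a + 1) *
            (risingFac (2 * a) (2 * L)) ^ 2 *
            (risingFac (2 * a + 2 * L) (2 * L)) ^ 2) *
          ((k / 2) ^ (2 * (L : ℂ) + a) / Complex.Gamma (1 + a + 2 * L)) =
      risingFac (2 * a) (2 * L) * (a + 2 * L) * risingFac (1 / 2) L /
        (a * ((2 * L).factorial : ℂ) * risingFac (2 * a + 3 / 2) L *
          risingFac (1 + a) (2 * L) ^ 2) * (-k ^ 2 / 4) ^ (2 * L) := by
  have haa : ∀ i : ℕ, a + i ≠ 0 := fun i h => ha (2 * i) (by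
    push_cast; linear_combination 2 * h)
  have hah : ∀ i : ℕ, a + 1 / 2 + i ≠ 0 := fun i h => ha (2 * i + 1) (by
    push_cast; linear_combination 2 * h)
  have ha1 : ∀ i : ℕ, 1 + a + i ≠ 0 := fun i h => haa (i + 1) (by
    push_cast; linear_combination h)
  have ha0 : a ≠ 0 := by simpa using haa 0
  have ha2 : ∀ i : ℕ, 1 + a + 2 * L + i ≠ 0 := fun i h => ha1 (2 * L + i) (by
    push_cast; linear_combination h)
  have hL : a + 2 * L ≠ 0 := by simpa using haa (2 * L)
  have g1 := Gamma_ne_zero_of_add_natCast haa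
  have g2 := Gamma_ne_zero_of_add_natCast hah
  have g3 := Gamma_ne_zero_of_add_natCast ha2
  have g4 := Gamma_ne_zero_of_add_natCast hc
  have g5 := Gamma_ne_zero_of_add_natCast ha
  have hpi : ((Real.sqrt Real.pi : ℝ) : ℂ) ≠ 0 := by
    exact_mod_cast (Real.sqrt_pos.2 Real.pi_pos).ne'
  have hdup := Complex.Gamma_mul_Gamma_add_half a
  have hpow : (2 : ℂ) ^ (1 - 2 * a) ≠ 0 := by
    rw [Complex.cpow_def_of_ne_zero two_ne_zero]; exact Complex.exp_ne_zero _
  have e1 : Complex.Gamma (1 + a) = a * Complex.Gamma a := by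
    rw [add_comm, Complex.Gamma_add_one _ ha0]
  have e2 : Complex.Gamma (2 * a + 2 * L) = risingFac (2 * a) (2 * L) * Complex.Gamma (2 * a) := by
    rw [← Gamma_add_natCast ha]; push_cast; rfl
  have e3 : pochhammerGamma (1 / 2 + L) (2 * a + 1) =
      risingFac (2 * a + 3 / 2) L * Complex.Gamma (2 * a + 3 / 2) /
        (risingFac (1 / 2) L * (Real.sqrt Real.pi : ℝ)) := by
    rw [pochhammerGamma, ← Gamma_add_natCast hc, Gamma_add_natCast half_add_natCast_ne_zero,
      Complex.Gamma_one_half_eq, show (1 / 2 + (L : ℂ) + (2 * a + 1)) = 2 * a + 3 / 2 + L by ring,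
      Real.sqrt_eq_rpow, Complex.ofReal_cpow Real.pi_pos.le]
    norm_num
  -- Both sides come from `(2a)_(4L)`: it splits at `2L` on the left and by duplication on the
  -- right, with `(a)_(2L) (a + 2L) = a (1 + a)_(2L)`.
  have e4 : risingFac (2 * a) (2 * L) * risingFac (2 * a + 2 * L) (2 * L) * (a + 2 * L) =
      4 ^ (2 * L) * risingFac (a + 1 / 2) (2 * L) * (a * risingFac (1 + a) (2 * L)) := by
    have h1 := risingFac_add (2 * a) (2 * L) (2 * L)
    rw [← two_mul, risingFac_two_mul] at h1
    have h2 := risingFac_succ a (2 * L)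
    rw [risingFac_succ_left, add_comm a 1] at h2
    push_cast at h1 h2
    rw [← h1, h2]
    ring
  have n1 := risingFac_ne_zero ha (2 * L)
  have n2 := risingFac_ne_zero hah (2 * L)
  have n3 := risingFac_ne_zero ha1 (2 * L)
  have n4 := risingFac_ne_zero hc L
  have n5 := risingFac_ne_zero half_add_natCast_ne_zero L
  have n6 : ((2 * L).factorial : ℂ) ≠ 0 := by exact_mod_cast (2 * L).factorial_ne_zero
  have n7 : risingFac (2 * a + 2 * L) (2 * L) ≠ 0 := by
    refine left_ne_zero_of_mul (b := a + 2 * L)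
      (right_ne_zero_of_mul (a := risingFac (2 * a) (2 * L)) ?_)
    rw [← mul_assoc, e4]
    exact mul_ne_zero (mul_ne_zero (pow_ne_zero _ (by norm_num)) n2) (mul_ne_zero ha0 n3)
  have e5 : risingFac (2 * a + 2 * L) (2 * L) = 4 ^ (2 * L) * risingFac (a + 1 / 2) (2 * L) *
      (a * risingFac (1 + a) (2 * L)) / (risingFac (2 * a) (2 * L) * (a + 2 * L)) := by
    rw [← e4]; field_simp
  have e6 : Complex.Gamma (a + 1 / 2) =
      Complex.Gamma (2 * a) * 2 ^ (1 - 2 * a) * (Real.sqrt Real.pi : ℝ) / Complex.Gamma a := by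
    rw [← hdup]; field_simp
  have hp := cpow_mul_cpow_mul_div_two_cpow hk a L
  have e7 : (-k ^ 2 / 4) ^ (2 * L) = k ^ (4 * L) / 4 ^ (2 * L) := by
    rw [div_pow, neg_pow, pow_mul (-1 : ℂ) 2 L, ← pow_mul]
    norm_num
    ring_nf
  have e8 : (2 : ℂ) ^ (4 * L) = 4 ^ (2 * L) := by
    rw [show 4 * L = 2 * (2 * L) by ring, pow_mul]; norm_num
  rw [e8] at hp
  have e9 : (-1 : ℂ) ^ (2 * L) = 1 := by rw [pow_mul]; norm_num
  rw [e9, e1, e2, e3, e5, e6, e7]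
  have n8 : (4 : ℂ) ^ (2 * L) ≠ 0 := pow_ne_zero _ (by norm_num)
  generalize (2 : ℂ) ^ (6 * (L : ℂ) - a + 1) = P1 at *
  generalize k ^ (2 * (L : ℂ) - a) = P2 at *
  generalize (k / 2) ^ (2 * (L : ℂ) + a) = P3 at *
  generalize (2 : ℂ) ^ (1 - 2 * a) = P4 at *
  generalize (4 : ℂ) ^ (2 * L) = P5 at *
  generalize k ^ (4 * L) = P6 at *
  generalize ((2 * L).factorial : ℂ) = P7 at *
  generalize risingFac (1 / 2) L = P8 at *
  generalize risingFac (a + 1 / 2) (2 * L) = P9 at *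
  generalize risingFac (2 * a) (2 * L) = P10 at *
  generalize risingFac (2 * a + 3 / 2) L = P11 at *
  generalize risingFac (1 + a) (2 * L) = P12 at *
  generalize Complex.Gamma (2 * a) = P13 at *
  generalize Complex.Gamma (2 * a + 3 / 2) = P14 at *
  generalize Complex.Gamma (1 + a + 2 * L) = P15 at *
  field_simp
  -- The only relation left between the remaining quantities is the one for the complex powers.
  linear_combination hp

/-! ### Specialisation to `c = 2a + 3/2`. -/

theorem mainTheorem10 (μ k : ℂ) (hk : k ≠ 0)
    (hμ₁ : ∀ n : ℕ, μ + 1 ≠ -(n : ℂ)) (hμ₂ : ∀ n : ℕ, μ - 1 / 2 ≠ -(n : ℂ)) :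
    HasSum
      (fun L : ℕ =>
        ((-1 : ℂ) ^ (2 * L) * (2 : ℂ) ^ (6 * (L : ℂ) - μ / 2 + 5 / 4) *
            Complex.Gamma (μ / 2 + 3 / 4) * Complex.Gamma (μ + 1) *
            k ^ (2 * (L : ℂ) - μ / 2 + 1 / 4) *
            (risingFac (μ / 2 + 1 / 4) (2 * L)) ^ 2 *
            Complex.Gamma (2 * (L : ℂ) + μ / 2 + 3 / 4) *
            Complex.Gamma (2 * (L : ℂ) + μ - 1 / 2)) /
          (((2 * L).factorial : ℂ) * (2 * (L : ℂ) + μ / 2 - 1 / 4) *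
            (Complex.Gamma (μ / 2 - 1 / 4)) ^ 2 * Complex.Gamma (μ / 2 + 1 / 4) *
            pochhammerGamma ((L : ℂ) + 1 / 2) (μ + 1 / 2) *
            (risingFac (μ - 1 / 2) (2 * L)) ^ 2 *
            (risingFac (2 * (L : ℂ) + μ - 1 / 2) (2 * L)) ^ 2) *
          besselJ (2 * (L : ℂ) + μ / 2 - 1 / 4) k *
          hypergeom1F2 ((L : ℂ) + 1 / 2) (2 * (L : ℂ) + μ / 2 + 3 / 4) ((L : ℂ) + μ + 1)
            (-k ^ 2 / 4))
      (hypergeom1F2 (μ / 2 + 1 / 4) (μ + 1 / 2) (μ + 1) (-k ^ 2)) := by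
  -- In terms of `a` the two exclusions say that neither `2a` nor `2a + 3/2` is a nonpositive
  -- integer.
  obtain ⟨a, rfl⟩ : ∃ a, μ = 2 * a + 1 / 2 := ⟨(μ - 1 / 2) / 2, by ring⟩
  have ha : ∀ i : ℕ, 2 * a + i ≠ 0 := fun i h => hμ₂ i (by linear_combination h)
  have hc : ∀ i : ℕ, 2 * a + 3 / 2 + i ≠ 0 := fun i h => hμ₁ i (by linear_combination h)
  have ha1 : ∀ i : ℕ, 1 + a + i ≠ 0 := fun i h => ha (2 * i + 2) (by
    push_cast; linear_combination 2 * h)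
  have ha2 : ∀ i : ℕ, 2 * a + 1 + i ≠ 0 := fun i h => ha (i + 1) (by
    push_cast; linear_combination h)
  have ha0 : a ≠ 0 := by simpa using ha 0
  have hmain := hasSum_tsum_mul_tsum ha0 ha1 hc (-k ^ 2 / 4)
  convert hmain using 1
  · funext L
    have hν : ∀ i : ℕ, 1 + (2 * (L : ℂ) + a) + i ≠ 0 := fun i h => ha1 (2 * L + i) (by
      push_cast; linear_combination h)
    rw [← coefficient_eq hk ha hc L,
      show 2 * (L : ℂ) + (2 * a + 1 / 2) / 2 - 1 / 4 = 2 * L + a by ring, besselJ_eq hν,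
      hypergeom1F2_eq,
      show 1 + (2 * (L : ℂ) + a) = 1 + a + 2 * L by ring,
      show 2 * (L : ℂ) + (2 * a + 1 / 2) / 2 + 3 / 4 = 1 + a + 2 * L by ring,
      show 6 * (L : ℂ) - (2 * a + 1 / 2) / 2 + 5 / 4 = 6 * L - a + 1 by ring,
      show (2 * a + 1 / 2) / 2 + 3 / 4 = 1 + a by ring,
      show 2 * a + 1 / 2 + 1 = 2 * a + 3 / 2 by ring,
      show 2 * (L : ℂ) - (2 * a + 1 / 2) / 2 + 1 / 4 = 2 * L - a by ring,
      show (2 * a + 1 / 2) / 2 + 1 / 4 = a + 1 / 2 by ring,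
      show 2 * (L : ℂ) + (2 * a + 1 / 2) - 1 / 2 = 2 * a + 2 * L by ring,
      show (2 * a + 1 / 2) / 2 - 1 / 4 = a by ring,
      show (L : ℂ) + 1 / 2 = 1 / 2 + L by ring,
      show 2 * a + 1 / 2 + 1 / 2 = 2 * a + 1 by ring,
      show 2 * a + 1 / 2 - 1 / 2 = 2 * a by ring,
      show (L : ℂ) + (2 * a + 1 / 2) + 1 = 2 * a + 3 / 2 + L by ring,
      add_comm (2 * (L : ℂ)) a]
    ring
  · rw [hypergeom1F2_eq]
    refine tsum_congr fun N => ?_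
    rw [show (2 * a + 1 / 2) / 2 + 1 / 4 = a + 1 / 2 by ring,
      show 2 * a + 1 / 2 + 1 / 2 = 2 * a + 1 by ring,
      show 2 * a + 1 / 2 + 1 = 2 * a + 3 / 2 by ring,
      show 1 / 2 + (2 * a + 3 / 2) + (N : ℂ) - 1 = 2 * a + 1 + N by ring]
    -- Here `1/2 + c = 2a + 2`, so the numerator is `(2a + 1 + N)_N = (2a + 1)_(2N) / (2a + 1)_N`.
    -- Duplication yields the `4^N` that changes `-k²/4` to `-k²`, and a factor `(1 + a)_N` that
    -- cancels the denominator.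
    have h1 := risingFac_add (2 * a + 1) N N
    rw [← two_mul, show 2 * a + 1 = 2 * (a + 1 / 2) by ring, risingFac_two_mul,
      show 2 * (a + 1 / 2) = 2 * a + 1 by ring, show a + 1 / 2 + 1 / 2 = 1 + a by ring] at h1
    have n1 := risingFac_ne_zero ha1 N
    have n2 := risingFac_ne_zero ha2 N
    have n3 := risingFac_ne_zero hc N
    have n4 : (N.factorial : ℂ) ≠ 0 := by exact_mod_cast N.factorial_ne_zero
    have n5 : (4 : ℂ) ^ N ≠ 0 := pow_ne_zero _ (by norm_num)
    rw [show risingFac (2 * a + 1 + N) N =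
      4 ^ N * risingFac (a + 1 / 2) N * risingFac (1 + a) N / risingFac (2 * a + 1) N by
        rw [h1, mul_div_cancel_left₀ _ n2], div_pow]
    field_simp
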